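/- Let $X$ be a set and let $Z\subseteq X$. Let $F(X)$ denote the free group over $X$, and identify the free group $F(Z)$ with the subgroup of $F(X)$ generated by $Z$, via the canonical monomorphism $F(Z)\to F(X)$ extending the inclusion $Z\hookrightarrow X$. A group topology on a group is a topology that makes multiplication and inversion continuous. Then for every separable metrizable group topology $\mathscr{T}$ on $F(Z)$ there exists a Hausdorff group topology $\mathscr{T}'$ on $F(X)$ that induces $\mathscr{T}$ on $F(Z)$; that is, $\mathscr{T}=\{U\cap F(Z): U\in\mathscr{T}'\}$, so that $(F(Z),\mathscr{T})$ is a subspace of $(F(X),\mathscr{T}')$. -/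

import Mathlib

open Filter Topology MeasureTheory
open scoped ENNReal

namespace FreeGroupTopology

/-! ### Uniform distance in measure. -/

section Distance

variable {G P : Type*}

/-! Let G = F(Z), P = F(X), and let r : F(X) → G be the retraction killing X \ Z. In the wreath
product of functions on G by G, the map w ↦ (k ↦ k⁻¹ w r(w)⁻¹ k, r(w)) is a homomorphism, faithful
already at k = 1. Its function components need not vary continuously under translation, so values in
P are replaced by step functions ℝ → P compared in measure (`stepApprox`), one approximation for
each finite S ⊆ G. Each S gives a group topology on F(X) for which both the inclusion of G and r are
continuous; hence so does their infimum, which therefore induces the given topology on G. It is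
Hausdorff: r separates the elements outside ker r from 1, and for w ≠ 1 in ker r a large S gives the
value w on some interval (0, δ) (`eventually_toWreath_left`). -/

/-- The supremum over `k` of the measure of the set where `a k` and `b k` differ. -/
noncomputable def unifDist (a b : G → ℝ → P) : ℝ≥0∞ :=
  ⨆ k, volume {t | a k t ≠ b k t}

theorem unifDist_self (a : G → ℝ → P) : unifDist a a = 0 := by
  simp [unifDist]

theorem volume_le_unifDist (a b : G → ℝ → P) (k : G) :
    volume {t | a k t ≠ b k t} ≤ unifDist a b :=
  le_iSup (fun k => volume {t | a k t ≠ b k t}) k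

theorem unifDist_mul_one_le [Group P] (a b : G → ℝ → P) :
    unifDist (a * b) 1 ≤ unifDist a 1 + unifDist b 1 := by
  refine iSup_le fun k => ?_
  refine le_trans ?_ (add_le_add (volume_le_unifDist a 1 k) (volume_le_unifDist b 1 k))
  refine le_trans (measure_mono ?_) (measure_union_le _ _)
  intro t ht
  by_contra h
  simp only [Set.mem_union, Set.mem_ofPred_eq, not_or, not_not] at h
  exact ht (by simp only [Pi.mul_apply, Pi.one_apply] at h ⊢; simp [h.1, h.2])

theorem unifDist_inv [Group P] (a b : G → ℝ → P) : unifDist a⁻¹ b⁻¹ = unifDist a b := by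
  simp [unifDist]

theorem unifDist_mulAutArrow [Group G] [Group P] (g : G) (a b : G → ℝ → P) :
    unifDist (mulAutArrow g a) (mulAutArrow g b) = unifDist a b := by
  apply (Equiv.mulLeft g⁻¹).iSup_congr
  intro k
  rfl

theorem unifDist_conj_one_le [Group P] (f a b : G → ℝ → P) :
    unifDist (f * a * b⁻¹) 1 ≤ unifDist a 1 + unifDist f b := by
  refine iSup_le fun k => ?_
  refine le_trans ?_ (add_le_add (volume_le_unifDist a 1 k) (volume_le_unifDist f b k))
  refine le_trans (measure_mono ?_) (measure_union_le _ _)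
  intro t ht
  by_contra h
  simp only [Set.mem_union, Set.mem_ofPred_eq, not_or, not_not] at h
  refine ht ?_
  simp only [Pi.mul_apply, Pi.one_apply, Pi.inv_apply] at h ⊢
  simp [h.1, h.2]

theorem mulAutArrow_eval [Group G] [Group P] (g k : G) (a : G → ℝ → P) :
    mulAutArrow g a k = a (g⁻¹ * k) :=
  rfl

end Distance

/-! ### Pulling back group topologies from the wreath product. -/

section Wreath

variable {G P : Type*} [Group G] [Group P] [TopologicalSpace G]

/-- The filter at `1` of elements whose `G`-component tends to `1` and whose function component
tends to `1` uniformly in measure. -/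
noncomputable def wreathFilter (G P : Type*) [Group G] [Group P] [TopologicalSpace G] :
    Filter ((G → ℝ → P) ⋊[mulAutArrow] G) :=
  comap (fun x => x.right) (𝓝 1) ⊓ comap (fun x => unifDist x.left 1) (𝓝 0)

theorem tendsto_wreathFilter_iff {α : Type*} {l : Filter α}
    {u : α → (G → ℝ → P) ⋊[mulAutArrow] G} :
    Tendsto u l (wreathFilter G P) ↔ Tendsto (fun x => (u x).right) l (𝓝 1) ∧
      Tendsto (fun x => unifDist (u x).left 1) l (𝓝 0) := by
  simp [wreathFilter, tendsto_inf, tendsto_comap_iff, Function.comp_def]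

theorem tendsto_right : Tendsto (fun x => x.right) (wreathFilter G P) (𝓝 1) :=
  (tendsto_wreathFilter_iff.1 tendsto_id).1

theorem tendsto_unifDist_left :
    Tendsto (fun x => unifDist x.left 1) (wreathFilter G P) (𝓝 0) :=
  (tendsto_wreathFilter_iff.1 tendsto_id).2

theorem pure_one_le_wreathFilter : pure 1 ≤ wreathFilter G P := by
  have : Tendsto id (pure 1) (wreathFilter G P) := by
    rw [tendsto_wreathFilter_iff]
    constructor
    · rw [tendsto_pure_left]
      intro U hU
      exact mem_of_mem_nhds hU
    · rw [tendsto_pure_left]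
      intro U hU
      simpa [unifDist_self] using mem_of_mem_nhds hU
  exact this

/-- Conjugation turns the function part a of (a, g) into f · a · (g • f)⁻¹, so f must be almost
invariant under small g. This fails for general f, so only suitable homomorphisms into the wreath
product yield topologies. -/
theorem tendsto_conj_inl {f : G → ℝ → P}
    (hf : Tendsto (fun g => unifDist f (mulAutArrow g f)) (𝓝 (1 : G)) (𝓝 0)) :
    Tendsto (fun x => SemidirectProduct.inl f * x * (SemidirectProduct.inl f)⁻¹)
      (wreathFilter G P) (wreathFilter G P) := by
  rw [tendsto_wreathFilter_iff]
  constructor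
  · simpa using (tendsto_right (G := G) (P := P))
  · have h := (tendsto_unifDist_left (G := G) (P := P)).add (hf.comp tendsto_right)
    rw [add_zero] at h
    refine tendsto_of_tendsto_of_tendsto_of_le_of_le tendsto_const_nhds h (fun _ => zero_le) ?_
    intro x
    have : (SemidirectProduct.inl f * x * (SemidirectProduct.inl f)⁻¹ :
        (G → ℝ → P) ⋊[mulAutArrow] G).left = f * x.left * (mulAutArrow x.right f)⁻¹ := by
      simp [← map_inv]
    simp only [this]
    exact unifDist_conj_one_le _ _ _

variable [IsTopologicalGroup G]

theorem tendsto_mul_wreathFilter :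
    Tendsto (fun x : ((G → ℝ → P) ⋊[mulAutArrow] G) × ((G → ℝ → P) ⋊[mulAutArrow] G) => x.1 * x.2)
      (wreathFilter G P ×ˢ wreathFilter G P) (wreathFilter G P) := by
  rw [tendsto_wreathFilter_iff]
  constructor
  · simpa using ((tendsto_right (G := G) (P := P)).comp
      (tendsto_fst (g := wreathFilter G P))).mul (tendsto_right.comp tendsto_snd)
  · have h := (tendsto_unifDist_left.comp
      (tendsto_fst (f := wreathFilter G P) (g := wreathFilter G P))).add
      (tendsto_unifDist_left.comp tendsto_snd)
    rw [add_zero] at h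
    refine tendsto_of_tendsto_of_tendsto_of_le_of_le tendsto_const_nhds h (fun _ => zero_le) ?_
    intro x
    refine (unifDist_mul_one_le _ _).trans (add_le_add le_rfl (le_of_eq ?_))
    conv_lhs => rw [← map_one (mulAutArrow (A := G) (M := ℝ → P) x.1.right)]
    exact unifDist_mulAutArrow _ _ _

theorem tendsto_inv_wreathFilter :
    Tendsto (fun x => x⁻¹) (wreathFilter G P) (wreathFilter G P) := by
  rw [tendsto_wreathFilter_iff]
  constructor
  · simpa using (tendsto_right (G := G) (P := P)).inv
  · refine tendsto_unifDist_left.congr fun x => ?_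
    conv_rhs =>
      rw [SemidirectProduct.inv_left, ← map_one (mulAutArrow (A := G) (M := ℝ → P) x.right⁻¹),
        unifDist_mulAutArrow, ← inv_one, unifDist_inv]

theorem tendsto_conj_inr (g : G) :
    Tendsto (fun x => SemidirectProduct.inr g * x * (SemidirectProduct.inr g)⁻¹)
      (wreathFilter G P) (wreathFilter G P) := by
  rw [tendsto_wreathFilter_iff]
  constructor
  · simpa using ((tendsto_right (G := G) (P := P)).const_mul g).mul_const g⁻¹
  · refine tendsto_unifDist_left.congr fun x => ?_
    have : (SemidirectProduct.inr g * x * (SemidirectProduct.inr g)⁻¹ :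
        (G → ℝ → P) ⋊[mulAutArrow] G).left = mulAutArrow g x.left := by
      simp [← map_inv]
    conv_rhs =>
      rw [this, ← map_one (mulAutArrow (A := G) (M := ℝ → P) g), unifDist_mulAutArrow]

/-- The group topology on `W` with neighbourhood filter of `1` pulled back from `wreathFilter`. -/
theorem exists_topology_nhds_one_eq_comap {W : Type*} [Group W]
    (Φ : W →* (G → ℝ → P) ⋊[mulAutArrow] G)
    (hΦ : ∀ w, Tendsto (fun x => Φ w * x * (Φ w)⁻¹) (wreathFilter G P) (wreathFilter G P)) :
    ∃ t : TopologicalSpace W, @IsTopologicalGroup W t _ ∧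
      @nhds W t 1 = comap Φ (wreathFilter G P) := by
  have hmem {U : Set W} : U ∈ (comap Φ (wreathFilter G P)).asBasis.sets ↔
      U ∈ comap Φ (wreathFilter G P) := Iff.rfl
  have hΦt : Tendsto Φ (comap Φ (wreathFilter G P)) (wreathFilter G P) := tendsto_comap
  let B : GroupFilterBasis W :=
    { (comap Φ (wreathFilter G P)).asBasis with
      one' := by
        intro U hU
        obtain ⟨V, hV, hVU⟩ := mem_comap.1 (hmem.1 hU)
        apply hVU
        rw [Set.mem_preimage, map_one]
        exact mem_pure.1 (pure_one_le_wreathFilter hV)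
      mul' := by
        intro U hU
        have h : Tendsto (fun x : W × W => x.1 * x.2)
            (comap Φ (wreathFilter G P) ×ˢ comap Φ (wreathFilter G P))
            (comap Φ (wreathFilter G P)) := by
          rw [tendsto_comap_iff]
          simpa [Function.comp_def] using tendsto_mul_wreathFilter.comp (hΦt.prodMap hΦt)
        obtain ⟨V, hV, hVU⟩ := mem_prod_same_iff.1 (h (hmem.1 hU))
        refine ⟨V, hV, ?_⟩
        rintro _ ⟨x, hx, y, hy, rfl⟩
        exact hVU (Set.mk_mem_prod hx hy)
      inv' := by
        intro U hU
        have h : Tendsto (fun x : W => x⁻¹) (comap Φ (wreathFilter G P))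
            (comap Φ (wreathFilter G P)) := by
          rw [tendsto_comap_iff]
          simpa [Function.comp_def] using tendsto_inv_wreathFilter.comp hΦt
        exact ⟨_, h (hmem.1 hU), subset_rfl⟩
      conj' := by
        intro w U hU
        have h : Tendsto (fun x : W => w * x * w⁻¹) (comap Φ (wreathFilter G P))
            (comap Φ (wreathFilter G P)) := by
          rw [tendsto_comap_iff]
          simpa [Function.comp_def] using (hΦ w).comp hΦt
        exact ⟨_, h (hmem.1 hU), subset_rfl⟩ }
  refine ⟨B.topology, B.isTopologicalGroup, ?_⟩
  rw [B.nhds_one_eq]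
  exact asBasis_filter _

end Wreath

/-! ### A metric uniformly continuous under translation. -/

section Metric

/-- The right uniformity is countably generated, hence metrizable, and whether (k, h⁻¹k) lies in a
basic entourage depends only on h; this gives uniformity in k. -/
theorem exists_separating_function (G : Type*) [Group G] [TopologicalSpace G]
    [IsTopologicalGroup G] [TopologicalSpace.MetrizableSpace G] :
    ∃ d : G → G → ℝ, (∀ k, d k k = 0) ∧ (∀ k s, k ≠ s → 0 < d k s) ∧
      ∀ ε > 0, ∀ᶠ h in 𝓝 (1 : G), ∀ k s, |d k s - d (h⁻¹ * k) s| ≤ ε := by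
  let := IsTopologicalGroup.rightUniformSpace G
  have : (uniformity G).IsCountablyGenerated := by
    rw [uniformity_eq_comap_nhds_one']
    infer_instance
  let := UniformSpace.metricSpace G
  refine ⟨dist, dist_self, fun k s h => dist_pos.2 h, fun ε hε => ?_⟩
  have h := Metric.dist_mem_uniformity (α := G) hε
  rw [uniformity_eq_comap_nhds_one'] at h
  obtain ⟨V, hV, hVs⟩ := mem_comap.1 h
  have hV' : ∀ᶠ h in 𝓝 (1 : G), h⁻¹ ∈ V := by
    have : Tendsto (fun h : G => h⁻¹) (𝓝 1) (𝓝 1) := by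
      simpa using (tendsto_id (x := 𝓝 (1 : G))).inv
    exact this hV
  filter_upwards [hV'] with g hg k s
  have : dist k (g⁻¹ * k) < ε := hVs (by simpa using hg : (k, g⁻¹ * k) ∈ _)
  exact (abs_dist_sub_le k (g⁻¹ * k) s).trans this.le

end Metric

/-! ### Step function approximations. -/

section Approximation

variable {G P : Type*} [Group P]

/-- The step function in `t` which equals `p s` for small `t` if `k = s ∈ S`. -/
noncomputable def stepApprox (d : G → G → ℝ) (p : G → P) (S : Finset G) (k : G) (t : ℝ) : P :=
  open Classical in ((S.filter fun s => d k s < t).toList.map p).prod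

/-- A small translation moves each threshold d(k, s) by at most ε, so the values change only on |S|
intervals of length at most ε. -/
theorem tendsto_unifDist_stepApprox [Group G] [TopologicalSpace G] {d : G → G → ℝ}
    (hd : ∀ ε > 0, ∀ᶠ h in 𝓝 (1 : G), ∀ k s, |d k s - d (h⁻¹ * k) s| ≤ ε)
    (p : G → P) (S : Finset G) :
    Tendsto (fun g => unifDist (stepApprox d p S) (mulAutArrow g (stepApprox d p S)))
      (𝓝 (1 : G)) (𝓝 0) := by
  have key : ∀ ε > 0, ∀ᶠ g in 𝓝 (1 : G),
      unifDist (stepApprox d p S) (mulAutArrow g (stepApprox d p S)) ≤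
        S.card * ENNReal.ofReal ε := by
    intro ε hε
    filter_upwards [hd ε hε] with g hg
    refine iSup_le fun k => ?_
    calc volume {t | stepApprox d p S k t ≠ stepApprox d p S (g⁻¹ * k) t}
        ≤ volume (⋃ s ∈ S, Set.uIcc (d k s) (d (g⁻¹ * k) s)) := by
          refine measure_mono fun t ht => ?_
          by_contra h
          refine ht ?_
          simp only [Set.mem_iUnion, not_exists] at h
          unfold stepApprox
          congr 3
          refine Finset.filter_congr fun s hs => ?_
          have := h s hs
          rw [Set.mem_uIcc] at this
          grind
      _ ≤ ∑ s ∈ S, volume (Set.uIcc (d k s) (d (g⁻¹ * k) s)) := measure_biUnion_finset_le _ _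
      _ ≤ ∑ _s ∈ S, ENNReal.ofReal ε := by
          refine Finset.sum_le_sum fun s _ => ?_
          rw [Real.volume_interval, abs_sub_comm]
          exact ENNReal.ofReal_le_ofReal (hg k s)
      _ = S.card * ENNReal.ofReal ε := by simp
  have hlim : Tendsto (fun ε : ℝ => (S.card : ℝ≥0∞) * ENNReal.ofReal ε) (𝓝[>] 0) (𝓝 0) := by
    have h := ENNReal.Tendsto.const_mul (a := (S.card : ℝ≥0∞))
      ((ENNReal.continuous_ofReal.tendsto 0).mono_left (nhdsWithin_le_nhds (s := Set.Ioi 0)))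
      (Or.inr (ENNReal.natCast_ne_top _))
    simpa using h
  rw [ENNReal.tendsto_nhds_zero]
  intro η hη
  obtain ⟨ε, hε, hε'⟩ :=
    (((ENNReal.tendsto_nhds_zero.1 hlim) η hη).and self_mem_nhdsWithin).exists
  exact (key ε hε').mono fun g hg => hg.trans hε

/-- Once k ∈ S, any t > 0 below the distances from k to the other points of S selects the factor at
k alone. -/
theorem eventually_stepApprox_eq {d : G → G → ℝ} (hd0 : ∀ k, d k k = 0)
    (hd : ∀ k s, k ≠ s → 0 < d k s) (p : G → P) (k : G) :
    ∀ᶠ S : Finset G in atTop, ∀ᶠ t in 𝓝[>] (0 : ℝ), stepApprox d p S k t = p k := by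
  classical
  filter_upwards [eventually_ge_atTop {k}] with S hS
  have hk : k ∈ S := hS (Finset.mem_singleton_self k)
  have h : ∀ᶠ t in 𝓝[>] (0 : ℝ), ∀ s ∈ S, s ≠ k → t < d k s := by
    rw [Finset.eventually_all]
    intro s _
    by_cases hs : s = k
    · simp [hs]
    · filter_upwards [nhdsWithin_le_nhds (Iio_mem_nhds (hd k s (Ne.symm hs)))] with t ht _
      exact ht
  filter_upwards [h, self_mem_nhdsWithin] with t ht ht0
  have : (S.filter fun s => d k s < t) = {k} := by
    ext s
    simp only [Finset.mem_filter, Finset.mem_singleton]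
    constructor
    · rintro ⟨hs, hlt⟩
      by_contra hne
      exact absurd (ht s hs hne) (not_lt.2 hlt.le)
    · rintro rfl
      exact ⟨hk, by rw [hd0]; exact ht0⟩
  simp [stepApprox, this]

end Approximation

/-! ### The homomorphisms from F(X). -/

section Extension

variable {X : Type*} (Z : Set X)

/-- The canonical monomorphism `F(Z) → F(X)`. -/
abbrev incl : FreeGroup Z →* FreeGroup X := FreeGroup.map Subtype.val

open Classical in
/-- The retraction of `F(X)` onto `F(Z)` killing the generators outside `Z`. -/
noncomputable def retract : FreeGroup X →* FreeGroup Z :=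
  FreeGroup.lift fun x => if h : x ∈ Z then FreeGroup.of ⟨x, h⟩ else 1

theorem retract_incl (g : FreeGroup Z) : retract Z (incl Z g) = g := by
  have : (retract Z).comp (incl Z) = MonoidHom.id _ := by
    ext z
    simp [retract]
  exact DFunLike.congr_fun this g

variable {Z} (d : FreeGroup Z → FreeGroup Z → ℝ) (S : Finset (FreeGroup Z))

open Classical in
/-- Generators in `Z` go to the complement, other generators `y` to step functions approximating
`k ↦ k⁻¹ y k`. -/
noncomputable def toWreath :
    FreeGroup X →* (FreeGroup Z → ℝ → FreeGroup X) ⋊[mulAutArrow] (FreeGroup Z) :=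
  FreeGroup.lift fun x => if h : x ∈ Z then SemidirectProduct.inr (FreeGroup.of ⟨x, h⟩)
    else SemidirectProduct.inl
      (stepApprox d (fun k => (incl Z k)⁻¹ * FreeGroup.of x * incl Z k) S)

theorem toWreath_right (w : FreeGroup X) : (toWreath d S w).right = retract Z w := by
  have : SemidirectProduct.rightHom.comp (toWreath d S) = retract Z := by
    ext x
    by_cases h : x ∈ Z <;> simp [toWreath, retract, h]
  exact DFunLike.congr_fun this w

theorem toWreath_incl (g : FreeGroup Z) : toWreath d S (incl Z g) = SemidirectProduct.inr g := by
  have : (toWreath d S).comp (incl Z) = SemidirectProduct.inr := by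
    apply FreeGroup.ext_hom
    intro z
    simp [toWreath]
  exact DFunLike.congr_fun this g

variable {d}

theorem tendsto_conj_toWreath [TopologicalSpace (FreeGroup Z)] [IsTopologicalGroup (FreeGroup Z)]
    (hd : ∀ ε > 0, ∀ᶠ h in 𝓝 (1 : FreeGroup Z), ∀ k s, |d k s - d (h⁻¹ * k) s| ≤ ε)
    (w : FreeGroup X) :
    Tendsto (fun x => toWreath d S w * x * (toWreath d S w)⁻¹)
      (wreathFilter (FreeGroup Z) (FreeGroup X)) (wreathFilter (FreeGroup Z) (FreeGroup X)) := by
  induction w using FreeGroup.induction_on with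
  | C1 => exact tendsto_id.congr fun u => by simp
  | of x =>
    by_cases h : x ∈ Z
    · simpa [toWreath, h] using
        tendsto_conj_inr (P := FreeGroup X) (FreeGroup.of ⟨x, h⟩ : FreeGroup Z)
    · simpa [toWreath, h] using tendsto_conj_inl (tendsto_unifDist_stepApprox hd
        (fun k => (incl Z k)⁻¹ * FreeGroup.of x * incl Z k) S)
  | inv_of x _ =>
    by_cases h : x ∈ Z
    · simpa [toWreath, h] using
        tendsto_conj_inr (P := FreeGroup X) (FreeGroup.of ⟨x, h⟩ : FreeGroup Z)⁻¹
    · have hf := tendsto_unifDist_stepApprox hd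
        (fun k => (incl Z k)⁻¹ * FreeGroup.of x * incl Z k) S
      have hf' := hf.congr fun g => (unifDist_inv _ _).symm
      simp only [← map_inv] at hf'
      simpa [toWreath, h] using tendsto_conj_inl hf'
  | mul x y hx hy =>
    refine (hx.comp hy).congr fun u => ?_
    simp [mul_assoc]

/-- The right-hand side obeys the cocycle rule of the semidirect product. A given word evaluates its
generators at finitely many points only, so one large S serves them all. -/
theorem eventually_toWreath_left (hd0 : ∀ k, d k k = 0) (hd : ∀ k s, k ≠ s → 0 < d k s)
    (w : FreeGroup X) : ∀ k, ∀ᶠ S : Finset (FreeGroup Z) in atTop, ∀ᶠ t in 𝓝[>] (0 : ℝ),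
      (toWreath d S w).left k t =
        (incl Z k)⁻¹ * w * (incl Z (retract Z w))⁻¹ * incl Z k := by
  induction w using FreeGroup.induction_on with
  | C1 => simp
  | of x =>
    intro k
    by_cases h : x ∈ Z
    · simp [toWreath, retract, h]
    · simpa [toWreath, retract, h] using eventually_stepApprox_eq hd0 hd
        (fun k => (incl Z k)⁻¹ * FreeGroup.of x * incl Z k) k
  | inv_of x hx =>
    intro k
    -- The function part of x⁻¹ at k is the inverse of that of x at r(x)k.
    filter_upwards [hx (retract Z (FreeGroup.of x) * k)] with S hS
    filter_upwards [hS] with t ht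
    rw [map_inv, SemidirectProduct.inv_left, toWreath_right, mulAutArrow_eval, Pi.inv_apply,
      Pi.inv_apply, inv_inv, ht]
    simp [mul_assoc]
  | mul x y hx hy =>
    intro k
    filter_upwards [hx k, hy ((retract Z x)⁻¹ * k)] with S hS hS'
    filter_upwards [hS, hS'] with t ht ht'
    rw [map_mul, SemidirectProduct.mul_left, toWreath_right, Pi.mul_apply, Pi.mul_apply,
      mulAutArrow_eval, ht, ht']
    simp [mul_assoc]

end Extension

end FreeGroupTopology

open FreeGroupTopology in
/-- For `Z ⊆ X`, the free group `F(Z)` is identified with the subgroup of `F(X)` generated by `Z`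
through the canonical monomorphism `FreeGroup.map (Subtype.val : Z → X)`. -/
theorem theorem3p4 {X : Type*} (Z : Set X)
    (T : TopologicalSpace (FreeGroup Z))
    (hT_group : @IsTopologicalGroup (FreeGroup Z) T _)
    (hT_metric : @TopologicalSpace.MetrizableSpace (FreeGroup Z) T)
    (hT_separable : @TopologicalSpace.SeparableSpace (FreeGroup Z) T) :
    ∃ T' : TopologicalSpace (FreeGroup X),
      @IsTopologicalGroup (FreeGroup X) T' _ ∧
      @T2Space (FreeGroup X) T' ∧
      T = TopologicalSpace.induced (FreeGroup.map (Subtype.val : Z → X)) T' := by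
  obtain ⟨d, hd0, hd, hdu⟩ := exists_separating_function (FreeGroup Z)
  choose t ht htn using fun S : Finset (FreeGroup Z) =>
    exists_topology_nhds_one_eq_comap (toWreath d S) (tendsto_conj_toWreath S hdu)
  have hgroup : @IsTopologicalGroup (FreeGroup X) (⨅ S, t S) _ := topologicalGroup_iInf ht
  have hincl : @Continuous _ _ T (⨅ S, t S) (incl Z) := by
    refine continuous_iInf_rng.2 fun S => ?_
    let := t S
    have := ht S
    refine continuous_of_continuousAt_one _ ?_
    rw [ContinuousAt, map_one, htn, tendsto_comap_iff, tendsto_wreathFilter_iff]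
    simp only [Function.comp_def, toWreath_incl, SemidirectProduct.right_inr,
      SemidirectProduct.left_inr, unifDist_self]
    exact ⟨tendsto_id, tendsto_const_nhds⟩
  have hretract : @Continuous _ _ (⨅ S, t S) T (retract Z) := by
    -- Any S would do: the G-component of `toWreath` is always r.
    refine continuous_iInf_dom (i := ∅) ?_
    let := t ∅
    have := ht ∅
    refine continuous_of_continuousAt_one _ ?_
    rw [ContinuousAt, map_one, htn]
    exact (tendsto_right.comp tendsto_comap).congr fun w => toWreath_right d ∅ w
  refine ⟨⨅ S, t S, hgroup, ?_, ?_⟩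
  · let : TopologicalSpace (FreeGroup X) := ⨅ S, t S
    refine IsTopologicalGroup.t2Space_of_one_sep fun w hw => ?_
    by_cases hr : retract Z w = 1
    -- At k = 1, with r(w) = 1, the limiting value is w itself.
    · obtain ⟨S, hS⟩ := (eventually_toWreath_left hd0 hd w 1).exists
      simp only [hr, map_one, inv_one, one_mul, mul_one] at hS
      obtain ⟨δ, hδ, hδS⟩ := mem_nhdsGT_iff_exists_Ioo_subset.1 hS
      have hpos : 0 < unifDist (toWreath d S w).left 1 := by
        refine lt_of_lt_of_le ?_ (volume_le_unifDist _ _ 1)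
        refine lt_of_lt_of_le ?_ (measure_mono (s := Set.Ioo 0 δ) fun s hs => ?_)
        · simpa using hδ
        · have := hδS hs
          simp only [Set.mem_ofPred_eq] at this
          simpa [this] using hw
      refine ⟨{v | unifDist (toWreath d S v).left 1 < unifDist (toWreath d S w).left 1}, ?_,
        by simp⟩
      refine nhds_mono (iInf_le t S) ?_
      rw [htn]
      exact (tendsto_unifDist_left.comp tendsto_comap).eventually (gt_mem_nhds hpos)
    · refine ⟨retract Z ⁻¹' {retract Z w}ᶜ, ?_, by simp⟩
      refine hretract.continuousAt ?_
      rw [map_one]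
      exact isOpen_compl_singleton.mem_nhds (Ne.symm hr)
  · refine le_antisymm (continuous_iff_le_induced.1 hincl) ?_
    have h : T = TopologicalSpace.induced (incl Z) (TopologicalSpace.induced (retract Z) T) := by
      rw [induced_compose]
      have : (retract Z : FreeGroup X → FreeGroup Z) ∘ incl Z = id := funext (retract_incl Z)
      rw [this, induced_id]
    conv_rhs => rw [h]
    exact induced_mono (continuous_iff_le_induced.1 hretract)
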